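/- For even $n$, let $\mathcal G_{n,0,q}$ be the following random graph on $n$ nodes. A bisection $V_1,V_2$ of the node set (two parts with $n/2$ nodes each) is chosen uniformly at random; then, independently, each pair $\{i,j\}$ with $i\in V_1$, $j\in V_2$ is made an edge with probability $q$, and there are no edges inside $V_1$ or inside $V_2$. There is a constant $C>0$ such that for every $q\in(0,1)$ (not depending on $n$), the following holds with probability tending to $1$ as $n\to\infty$ over the even integers. Let $$d_{\mathrm{reg}} = \frac{qn}{2} + C\sqrt{\frac n2\log\frac n2}.$$ Then $G\sim\mathcal G_{n,0,q}$ is a subgraph of a $d$-regular bipartite graph on the same nodes with the same bipartition $V_1,V_2$, for each of the integers $d=\lfloor d_{\mathrm{reg}}\rfloor$ and $d=\lceil d_{\mathrm{reg}}\rceil$ (so for $d=d_{\mathrm{reg}}$ if this number is an integer). -/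

import Mathlib

open MeasureTheory ProbabilityTheory Filter Topology

namespace StochasticBlockModel

/-- The bisections of the node set `Fin n`: sets `A` containing exactly half of the nodes.  Such an
`A` stands for the bisection into the two parts `A` and `Aᶜ`. -/
def bisections (n : ℕ) : Set (Set (Fin n)) :=
  {A | 2 * A.ncard = n}

/-- The unordered pair `e` has one endpoint in `A` and the other one outside `A`. -/
def Crosses {V : Type*} (A : Set V) (e : Sym2 V) : Prop :=
  ∃ u ∈ A, ∃ v ∈ Aᶜ, e = s(u, v)

open Classical in
/-- The probability with which the pair `e` becomes an edge: `q` for a pair of nodes in different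
parts of the bisection `A`, `Aᶜ`, and `p` for a pair of nodes in the same part. -/
noncomputable def edgeProb {V : Type*} (A : Set V) (p q : unitInterval) (e : Sym2 V) :
    unitInterval :=
  if Crosses A e then q else p

/-- The law of the random graph with planted bisection `A`, `Aᶜ`: every unordered pair `e` of
distinct nodes is an edge with probability `edgeProb A p q e`, independently of all others.
(`SimpleGraph.fromEdgeSet` ignores the diagonal pairs `s(v, v)`.) -/
noncomputable def plantedGraph (n : ℕ) (p q : unitInterval) (A : Set (Fin n)) :
    Measure (SimpleGraph (Fin n)) :=
  (Measure.pi fun e : Sym2 (Fin n) => bernoulliMeasure True False (edgeProb A p q e)).map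
    fun ω => SimpleGraph.fromEdgeSet {e | ω e}

instance (n : ℕ) (p q : unitInterval) (A : Set (Fin n)) :
    IsProbabilityMeasure (plantedGraph n p q A) :=
  Measure.isProbabilityMeasure_map (SimpleGraph.measurable_fromEdgeSet.comp
    (measurable_set_iff.2 fun e => measurable_pi_apply e)).aemeasurable

instance (n : ℕ) (p q : unitInterval) :
    IsMarkovKernel (Kernel.ofFunOfCountable (plantedGraph n p q)) :=
  ⟨fun A => inferInstanceAs (IsProbabilityMeasure (plantedGraph n p q A))⟩

/-- The stochastic block model on `n` nodes (`n` even) with edge probabilities `p` and `q`, as the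
joint law of the planted bisection and the graph: a bisection `A`, `Aᶜ` is chosen uniformly at
random, and, given `A`, the graph has law `plantedGraph n p q A`. -/
noncomputable def sbm (n : ℕ) (p q : unitInterval) :
    Measure (Set (Fin n) × SimpleGraph (Fin n)) :=
  uniformOn (bisections n) ⊗ₘ Kernel.ofFunOfCountable (plantedGraph n p q)

/-- `G` is a subgraph of some `d`-regular bipartite graph `H` on the same nodes with bipartition
`A`, `Aᶜ`. -/
def IsSubgraphOfRegularBipartite {V : Type*} (G : SimpleGraph V) (A : Set V) (d : ℕ) : Prop :=
  ∃ (H : SimpleGraph V) (_ : H.LocallyFinite),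
    G ≤ H ∧ H.IsBipartiteWith A Aᶜ ∧ H.IsRegularOfDegree d

/-- The real number `q n / 2 + C √((n / 2) log (n / 2))`. -/
noncomputable def dReg (C q : ℝ) (n : ℕ) : ℝ :=
  q * n / 2 + C * Real.sqrt ((n : ℝ) / 2 * Real.log ((n : ℝ) / 2))

end StochasticBlockModel

/-! Put m = n/2, p = 1 - q and w = √(m log m), and pass to the bipartite complement: G lies in a
d-regular bipartite graph on `A`, `Aᶜ` as soon as its crossing non-edges contain a k-factor with k =
m - d, because that factor can be removed from the complete bipartite graph. With C = 2, k is within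
1 of pm - 2w, just below the smallest degree pm - w to be expected among the non-edges.

A k-factor exists once k|S| ≤ e(S, Tᶜ) + k|T| for all S and T (`exists_factor`, from Hall's
theorem). This is checked for pseudorandom graphs in `exists_factor_of_pseudorandom`: degree bounds
handle small S or small Tᶜ, edge counts between sets handle the rest.

Hoeffding's inequality and union bounds supply both inputs. The 2m degrees fail with total
probability at most 2/m; the 4^m pairs (S, T) may each deviate by pwm/4 and fail with total
probability at most 4^m exp(-p² m log m / 8). These bounds do not depend on the bisection, so they
survive averaging over it. -/

namespace StochasticBlockModel

/-! ### Factors of bipartite graphs via Hall's theorem -/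

section Factor

variable {α β : Type*} [Fintype β] [DecidableEq α] [DecidableEq β]

/-- The incidence relation of the bipartite graph whose perfect matchings are the `k`-factors of
the bipartite graph with edge set `B`. -/
def factorRel (B : Finset (α × β)) (k : ℕ) : (α × Fin k) ⊕ B → B ⊕ (β × Fin k) → Prop
  | .inl x, .inl e => e.1.1 = x.1
  | .inl _, .inr _ => False
  | .inr e, .inl e' => e = e'
  | .inr e, .inr y => e.1.2 = y.1

/-- The degree condition for `k`-factors implies Hall's condition for `factorRel`. -/
theorem exists_injective_factorRel (B : Finset (α × β)) (k : ℕ)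
    (h : ∀ (S : Finset α) (T : Finset β),
      k * S.card ≤ (B.filter fun e => e.1 ∈ S ∧ e.2 ∉ T).card + k * T.card) :
    ∃ f : (α × Fin k) ⊕ B → B ⊕ (β × Fin k),
      Function.Injective f ∧ ∀ x, factorRel B k x (f x) := by
  classical
  refine (Fintype.all_card_le_filter_rel_iff_exists_injective (factorRel B k)).1 fun A => ?_
  -- `S` and `T` are the nodes met by the two halves of `A`. Its neighbours include the edges of
  -- `A.toRight`, all `k` copies of each node of `T`, and the edges `X` from `S` to outside `T`,
  -- which cannot lie in `A.toRight`.
  set S : Finset α := A.toLeft.image Prod.fst with hS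
  set T : Finset β := A.toRight.image (fun e => e.1.2) with hT
  set X : Finset B := Finset.univ.filter (fun e : B => e.1.1 ∈ S ∧ e.1.2 ∉ T) with hX
  have h1 : A.toLeft.card ≤ k * S.card := by
    have : A.toLeft ⊆ S ×ˢ (Finset.univ : Finset (Fin k)) := by
      intro x hx
      simp only [Finset.mem_product, Finset.mem_univ, and_true]
      exact Finset.mem_image_of_mem _ hx
    simpa [mul_comm] using Finset.card_le_card this
  have h2 : (B.filter fun e => e.1 ∈ S ∧ e.2 ∉ T).card = X.card := by
    refine Finset.card_bij' (fun e he => ⟨e, (Finset.mem_filter.1 he).1⟩) (fun e _ => e.1) ?_ ?_ ?_ ?_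
      <;> simp +contextual [hX]
  have h3 : Disjoint A.toRight X := by
    rw [Finset.disjoint_left]
    intro e he hx
    exact (Finset.mem_filter.1 hx).2.2 (Finset.mem_image_of_mem (fun e : B => e.1.2) he)
  have h4 : (A.toRight ∪ X).disjSum (T ×ˢ (Finset.univ : Finset (Fin k))) ⊆
      Finset.univ.filter (fun b => ∃ a ∈ A, factorRel B k a b) := by
    intro y hy
    simp only [Finset.mem_filter, Finset.mem_univ, true_and]
    rcases y with e | y
    · rw [Finset.inl_mem_disjSum, Finset.mem_union] at hy
      rcases hy with hy | hy
      · exact ⟨.inr e, Finset.mem_toRight.1 hy, rfl⟩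
      · obtain ⟨x, hx, hxe⟩ := Finset.mem_image.1 (Finset.mem_filter.1 hy).2.1
        exact ⟨.inl x, Finset.mem_toLeft.1 hx, hxe.symm⟩
    · rw [Finset.inr_mem_disjSum, Finset.mem_product] at hy
      obtain ⟨e, he, hey⟩ := Finset.mem_image.1 hy.1
      exact ⟨.inr e, Finset.mem_toRight.1 he, hey⟩
  have h5 := Finset.card_le_card h4
  rw [Finset.card_disjSum, Finset.card_union_of_disjoint h3, Finset.card_product, Finset.card_univ,
    Fintype.card_fin] at h5
  have h6 := h S T
  have h7 := A.card_toLeft_add_card_toRight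
  rw [h2] at h6
  have h8 := mul_comm k T.card
  refine le_trans ?_ h5
  omega

variable [Fintype α]

/-- A bipartite graph with parts of equal size has a `k`-factor as soon as
`k |S| ≤ e(S, Tᶜ) + k |T|` for all sets `S` and `T` of nodes in the two parts. -/
theorem exists_factor (B : Finset (α × β)) (k : ℕ) (hcard : Fintype.card α = Fintype.card β)
    (h : ∀ (S : Finset α) (T : Finset β),
      k * S.card ≤ (B.filter fun e => e.1 ∈ S ∧ e.2 ∉ T).card + k * T.card) :
    ∃ F ⊆ B, (∀ a, (F.filter fun e => e.1 = a).card = k) ∧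
      ∀ b, (F.filter fun e => e.2 = b).card = k := by
  classical
  obtain ⟨f, hf, hr⟩ := exists_injective_factorRel B k h
  have hsurj : Function.Surjective f :=
    ((Fintype.bijective_iff_injective_and_card f).2 ⟨hf, by
      simp [hcard, add_comm]⟩).2
  have hrow : ∀ a (i : Fin k), ∃ e : B, f (.inl (a, i)) = .inl e ∧ e.1.1 = a := by
    intro a i
    have := hr (.inl (a, i))
    rcases hfa : f (.inl (a, i)) with e | y
    · rw [hfa] at this
      exact ⟨e, rfl, this⟩
    · rw [hfa] at this
      exact this.elim
  have hcol : ∀ b (i : Fin k), ∃ e : B, f (.inr e) = .inr (b, i) ∧ e.1.2 = b := by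
    intro b i
    obtain ⟨x, hx⟩ := hsurj (.inr (b, i))
    have := hr x
    rw [hx] at this
    rcases x with x | e
    · exact this.elim
    · exact ⟨e, hx, this⟩
  choose φ hφ hφ' using hrow
  choose ψ hψ hψ' using hcol
  -- Every edge has a left and a right copy. It is selected when its left copy is matched to a node
  -- of `β`; its right copy must then be matched to a node of `α`. An unselected edge has its two
  -- copies matched to each other.
  refine ⟨(Finset.univ.filter fun e : B => (f (.inr e)).isRight).map (.subtype _), ?_, ?_, ?_⟩
  · intro e he
    obtain ⟨e', -, rfl⟩ := Finset.mem_map.1 he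
    exact e'.2
  · intro a
    have : ((Finset.univ.filter fun e : B => (f (.inr e)).isRight).map (.subtype _)).filter
        (fun e => e.1 = a) = Finset.univ.image (fun i => (φ a i).1) := by
      ext e
      simp only [Finset.mem_filter, Finset.mem_map, Finset.mem_univ, true_and, Finset.mem_image,
        Function.Embedding.subtype_apply]
      constructor
      · rintro ⟨⟨e, he, rfl⟩, rfl⟩
        obtain ⟨x, hx⟩ := hsurj (.inl e)
        have hrx := hr x
        rw [hx] at hrx
        rcases x with ⟨a, i⟩ | e'
        · obtain rfl : e.1.1 = a := hrx
          refine ⟨i, ?_⟩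
          have := hφ e.1.1 i
          rw [hx] at this
          rw [← Sum.inl.inj this]
        · obtain rfl : e' = e := hrx
          rw [hx] at he
          simp at he
      · rintro ⟨i, rfl⟩
        refine ⟨⟨φ a i, ?_, rfl⟩, hφ' a i⟩
        have hre := hr (.inr (φ a i))
        rcases hfe : f (.inr (φ a i)) with e' | y
        · rw [hfe] at hre
          obtain rfl : φ a i = e' := hre
          rw [← hφ a i] at hfe
          exact absurd (hf hfe) (by simp)
        · rfl
    rw [this, Finset.card_image_of_injective, Finset.card_univ, Fintype.card_fin]
    intro i j hij
    have := hφ a i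
    rw [Subtype.ext hij, ← hφ a j] at this
    simpa using hf this
  · intro b
    have : ((Finset.univ.filter fun e : B => (f (.inr e)).isRight).map (.subtype _)).filter
        (fun e => e.2 = b) = Finset.univ.image (fun i => (ψ b i).1) := by
      ext e
      simp only [Finset.mem_filter, Finset.mem_map, Finset.mem_univ, true_and, Finset.mem_image,
        Function.Embedding.subtype_apply]
      constructor
      · rintro ⟨⟨e, he, rfl⟩, rfl⟩
        have hre := hr (.inr e)
        rcases hfe : f (.inr e) with e' | ⟨b, i⟩
        · rw [hfe] at he
          simp at he
        · rw [hfe] at hre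
          obtain rfl : e.1.2 = b := hre
          refine ⟨i, ?_⟩
          rw [← hψ e.1.2 i] at hfe
          exact congrArg Subtype.val (Sum.inr.inj (hf hfe)).symm
      · rintro ⟨i, rfl⟩
        exact ⟨⟨ψ b i, by simp [hψ], rfl⟩, hψ' b i⟩
    rw [this, Finset.card_image_of_injective, Finset.card_univ, Fintype.card_fin]
    intro i j hij
    have := hψ b i
    rw [Subtype.ext hij, hψ b j] at this
    simpa using this.symm

/-- A dense bipartite graph with parts of size `m`, in which all degrees are at least `p m - w` and
the number of edges between any two sets of nodes is at least its typical value `p |S| |T|` up to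
an error `p w m / 4`, has a `k`-factor. -/
theorem exists_factor_of_pseudorandom (B : Finset (α × β)) (k m : ℕ) (p w : ℝ)
    (hα : Fintype.card α = m) (hβ : Fintype.card β = m)
    (hp : 0 < p) (hw : 0 ≤ w) (hwm : 4 * w ≤ p ^ 2 * m)
    (hk : (k : ℝ) ≤ p * m - w) (hk' : p * m / 2 ≤ k)
    (hrow : ∀ a, p * m - w ≤ (B.filter fun e => e.1 = a).card)
    (hcol : ∀ b, p * m - w ≤ (B.filter fun e => e.2 = b).card)
    (hST : ∀ (S : Finset α) (T : Finset β),
      p * S.card * T.card - p / 4 * w * m ≤ (B.filter fun e => e.1 ∈ S ∧ e.2 ∈ T).card) :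
    ∃ F ⊆ B, (∀ a, (F.filter fun e => e.1 = a).card = k) ∧
      ∀ b, (F.filter fun e => e.2 = b).card = k := by
  refine exists_factor B k (hα.trans hβ.symm) fun S T => ?_
  have hSm : (S.card : ℝ) ≤ m := by exact_mod_cast hα ▸ S.card_le_univ
  have hTm : (T.card : ℝ) ≤ m := by exact_mod_cast hβ ▸ T.card_le_univ
  have hTc : ((Tᶜ : Finset β).card : ℝ) = m - T.card := by
    rw [Finset.card_compl, hβ, Nat.cast_sub (hβ ▸ T.card_le_univ)]
  have hSc : ((Sᶜ : Finset α).card : ℝ) = m - S.card := by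
    rw [Finset.card_compl, hα, Nat.cast_sub (hα ▸ S.card_le_univ)]
  have hmain := hST S Tᶜ
  simp only [Finset.mem_compl] at hmain
  rw [hTc] at hmain
  suffices (k : ℝ) * S.card ≤ (B.filter fun e => e.1 ∈ S ∧ e.2 ∉ T).card + k * T.card by
    exact_mod_cast this
  have hk0 : (0 : ℝ) ≤ k := k.cast_nonneg
  have hT0 : (0 : ℝ) ≤ T.card := Nat.cast_nonneg _
  have hS0 : (0 : ℝ) ≤ S.card := Nat.cast_nonneg _
  -- For |S| ≤ k, the row degrees suffice: at most |S||T| ≤ k|T| edges from S are lost to T.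
  rcases le_total (S.card : ℝ) k with hSk | hSk
  · have h1 : (k : ℝ) * S.card ≤ (B.filter fun e => e.1 ∈ S).card := by
      have : (B.filter fun e => e.1 ∈ S).card =
          ∑ a ∈ S, (B.filter fun e => e.1 = a).card := by
        rw [Finset.card_eq_sum_card_fiberwise (f := Prod.fst) (t := S) (by intro e; simp)]
        refine Finset.sum_congr rfl fun a ha => ?_
        rw [Finset.filter_filter]
        congr 1
        refine Finset.filter_congr fun e _ => ?_
        constructor
        · exact fun h => h.2
        · exact fun h => ⟨h ▸ ha, h⟩
      rw [this, Nat.cast_sum, mul_comm, ← nsmul_eq_mul]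
      exact Finset.card_nsmul_le_sum _ _ _ fun a _ => hk.trans (hrow a)
    have h2 : ((B.filter fun e => e.1 ∈ S).card : ℝ) ≤
        (B.filter fun e => e.1 ∈ S ∧ e.2 ∉ T).card + S.card * T.card := by
      have : (B.filter fun e => e.1 ∈ S) ⊆ (B.filter fun e => e.1 ∈ S ∧ e.2 ∉ T) ∪ S ×ˢ T := by
        intro e he
        simp only [Finset.mem_union, Finset.mem_filter, Finset.mem_product] at he ⊢
        tauto
      have := (Finset.card_le_card this).trans (Finset.card_union_le _ _)
      rw [Finset.card_product] at this
      exact_mod_cast this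
    nlinarith
  -- The mirror image, for |Tᶜ| ≤ k, with column degrees.
  rcases le_total ((m : ℝ) - T.card) k with hTk | hTk
  · have h1 : (k : ℝ) * (m - T.card) ≤ (B.filter fun e => e.2 ∉ T).card := by
      have : (B.filter fun e => e.2 ∉ T).card =
          ∑ b ∈ Tᶜ, (B.filter fun e => e.2 = b).card := by
        rw [Finset.card_eq_sum_card_fiberwise (f := Prod.snd) (t := Tᶜ) (by intro e; simp)]
        refine Finset.sum_congr rfl fun a ha => ?_
        rw [Finset.filter_filter]
        congr 1
        refine Finset.filter_congr fun e _ => ?_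
        constructor
        · exact fun h => h.2
        · exact fun h => ⟨h ▸ Finset.mem_compl.1 ha, h⟩
      rw [this, Nat.cast_sum, mul_comm, ← hTc, ← nsmul_eq_mul]
      exact Finset.card_nsmul_le_sum _ _ _ fun a _ => hk.trans (hcol a)
    have h2 : ((B.filter fun e => e.2 ∉ T).card : ℝ) ≤
        (B.filter fun e => e.1 ∈ S ∧ e.2 ∉ T).card + (m - S.card) * (m - T.card) := by
      have : (B.filter fun e => e.2 ∉ T) ⊆
          (B.filter fun e => e.1 ∈ S ∧ e.2 ∉ T) ∪ Sᶜ ×ˢ Tᶜ := by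
        intro e he
        simp only [Finset.mem_union, Finset.mem_filter, Finset.mem_product,
          Finset.mem_compl] at he ⊢
        tauto
      have := (Finset.card_le_card this).trans (Finset.card_union_le _ _)
      rw [Finset.card_product] at this
      rw [← hSc, ← hTc]
      exact_mod_cast this
    nlinarith
  set s : ℝ := (S.card : ℝ)
  set r : ℝ := (T.card : ℝ)
  set M : ℝ := (m : ℝ)
  refine le_of_sub_nonneg ?_
  by_cases hsr : s ≤ r
  · have : (0 : ℝ) ≤ (B.filter fun e => e.1 ∈ S ∧ e.2 ∉ T).card := Nat.cast_nonneg _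
    nlinarith
  push Not at hsr
  have hM : 0 ≤ M := Nat.cast_nonneg _
  -- Since s(M - r) = M(s - r) + (M - s)r, the right side is the surplus of ps(M - r) over (pM -
  -- w)(s - r). If s - r is below pM/4, then r and M - s are both at least pM/4, as s and M - r are
  -- at least k ≥ pM/2.
  have key : p / 4 * w * M ≤ w * (s - r) + p * ((M - s) * r) := by
    rcases le_total (p / 4 * M) (s - r) with hc | hc
    · have : 0 ≤ (M - s) * r := mul_nonneg (by linarith) hT0
      nlinarith
    · have h1 : p / 4 * M ≤ M - s := by nlinarith
      have h2 : p / 4 * M ≤ r := by linarith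
      have h3 : (p / 4 * M) * (p / 4 * M) ≤ (M - s) * r :=
        mul_le_mul h1 h2 (by positivity) (by linarith)
      have h4 : p / 4 * M * (4 * w) ≤ p / 4 * M * (p ^ 2 * M) :=
        mul_le_mul_of_nonneg_left hwm (by positivity)
      have h5 := mul_le_mul_of_nonneg_left h3 hp.le
      have h6 : 0 ≤ w * (s - r) := mul_nonneg hw (by linarith)
      nlinarith
  have hks : (k : ℝ) * (s - r) ≤ (p * M - w) * (s - r) :=
    mul_le_mul_of_nonneg_right hk (by linarith)
  nlinarith

end Factor

/-! ### Hoeffding bounds for independent pairs -/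

section Concentration

open Classical in
/-- Hoeffding's inequality for the number of pairs in `E` that are not chosen, when every pair in
`E` is chosen with probability `q`, independently of all others. -/
theorem measureReal_card_filter_not_le {ι : Type*} [Fintype ι] (P : ι → unitInterval)
    (q : unitInterval) (E : Finset ι) (hE : ∀ e ∈ E, P e = q) {l : ℝ} (hl : 0 ≤ l) :
    (Measure.pi fun e => bernoulliMeasure True False (P e)).real
      {ω | ((E.filter fun e => ¬ ω e).card : ℝ) ≤ (1 - q) * E.card - l} ≤
      Real.exp (-2 * l ^ 2 / E.card) := by
  set μ := Measure.pi fun e => bernoulliMeasure True False (P e) with hμ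
  let g : Prop → ℝ := fun x => if x then 1 else 0
  have hg : Measurable g := measurable_of_finite g
  have hmean : ∀ e, ∫ ω, g (ω e) ∂μ = P e := by
    intro e
    have := (measurePreserving_eval (fun e => bernoulliMeasure True False (P e)) e)
    rw [← integral_map (φ := fun ω : ι → Prop => ω e) (measurable_pi_apply e).aemeasurable
      hg.aestronglyMeasurable]
    have hm := this.map_eq
    rw [hμ, show (fun ω : ι → Prop => ω e) = Function.eval e from rfl, hm, integral_bernoulliMeasure]
    simp [g]
  have hind : iIndepFun (fun e (ω : ι → Prop) => g (ω e) - P e) μ :=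
    iIndepFun_pi (X := fun e x => g x - P e) fun e => (hg.sub_const _).aemeasurable
  have hsub : ∀ e ∈ E, HasSubgaussianMGF (fun ω : ι → Prop => g (ω e) - P e)
      ((‖(1 : ℝ) - 0‖₊ / 2) ^ 2) μ := by
    intro e _
    have := hasSubgaussianMGF_of_mem_Icc (μ := μ) (X := fun ω : ι → Prop => g (ω e)) (a := 0)
      (b := 1) (hg.comp (measurable_pi_apply e)).aemeasurable
      (.of_forall fun ω => by by_cases h : ω e <;> simp [g, h])
    rwa [hmean e] at this
  have := HasSubgaussianMGF.measure_sum_ge_le_of_iIndepFun hind hsub hl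
  refine le_trans (measureReal_mono ?_) (this.trans ?_)
  · intro ω hω
    simp only [Set.mem_ofPred_eq] at hω ⊢
    have h1 : ∑ e ∈ E, (g (ω e) - P e) = (E.filter fun e => ω e).card - q * E.card := by
      rw [Finset.sum_sub_distrib, Finset.sum_congr rfl
        (fun e he => show (P e : ℝ) = q by rw [hE e he])]
      simp [g, mul_comm]
    have h2 : ((E.filter fun e => ω e).card : ℝ) + (E.filter fun e => ¬ ω e).card = E.card := by
      exact_mod_cast Finset.card_filter_add_card_filter_not (s := E) (fun e => ω e)
    rw [h1]
    linarith
  · refine Real.exp_le_exp.2 (le_of_eq ?_)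
    simp
    ring

open Classical in
/-- Union bound for the deviations of the numbers of unchosen pairs in a finite family of sets of
pairs. -/
theorem measureReal_exists_card_filter_not_le {ι κ : Type*} [Fintype ι] [Fintype κ]
    (P : ι → unitInterval) (q : unitInterval) (E : κ → Finset ι) (hE : ∀ i, ∀ e ∈ E i, P e = q)
    {M : ℝ} (hM : ∀ i, ((E i).card : ℝ) ≤ M) {l : ℝ} (hl : 0 < l) :
    (Measure.pi fun e => bernoulliMeasure True False (P e)).real
      {ω | ∃ i, (((E i).filter fun e => ¬ ω e).card : ℝ) < (1 - q) * (E i).card - l} ≤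
      Fintype.card κ * Real.exp (-2 * l ^ 2 / M) := by
  have hset : {ω : ι → Prop | ∃ i, (((E i).filter fun e => ¬ ω e).card : ℝ) <
      (1 - q) * (E i).card - l} = ⋃ i, {ω : ι → Prop |
        (((E i).filter fun e => ¬ ω e).card : ℝ) < (1 - q) * (E i).card - l} := by
    ext; simp
  rw [hset]
  refine (measureReal_iUnion_fintype_le _).trans ?_
  rw [← nsmul_eq_mul, ← Finset.card_univ]
  refine Finset.sum_le_card_nsmul _ _ _ fun i _ => ?_
  -- An empty `E i` is treated apart: the exponent cannot be compared through division by zero, but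
  -- the event is then impossible.
  rcases Nat.eq_zero_or_pos (E i).card with h0 | h0
  · have : {ω : ι → Prop | (((E i).filter fun e => ¬ ω e).card : ℝ) <
        (1 - q) * (E i).card - l} = ∅ := by
      ext ω
      simp only [Set.mem_ofPred_eq, Set.mem_empty_iff_false, iff_false, not_lt, h0]
      have : (0 : ℝ) ≤ ((E i).filter fun e => ¬ ω e).card := Nat.cast_nonneg _
      simp only [Nat.cast_zero, mul_zero]
      linarith
    rw [this, measureReal_empty]
    positivity
  · refine (measureReal_mono ?_).trans
      ((measureReal_card_filter_not_le P q (E i) (hE i) hl.le).trans ?_)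
    · intro ω hω
      simp only [Set.mem_ofPred_eq] at hω ⊢
      exact hω.le
    · refine Real.exp_le_exp.2 ?_
      have : (0 : ℝ) < (E i).card := Nat.cast_pos.2 h0
      rw [neg_mul, neg_div, neg_div, neg_le_neg_iff]
      exact div_le_div_of_nonneg_left (by positivity) this (hM i)

end Concentration

/-! ### From a factor of the non-edges to a regular supergraph -/

open Classical in
/-- If the crossing non-edges of a bipartite graph with parts of size `d + k` contain a `k`-factor,
then the graph is contained in a `d`-regular bipartite graph. -/
theorem isSubgraphOfRegularBipartite_of_factor {V : Type*} [Fintype V] (G : SimpleGraph V)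
    (A : Set V) (hG : ∀ u v, G.Adj u v → Crosses A s(u, v)) (d k : ℕ)
    (hA : Fintype.card A = d + k) (hAc : Fintype.card (Aᶜ : Set V) = d + k)
    (F : Finset (A × (Aᶜ : Set V))) (hF : ∀ e ∈ F, ¬ G.Adj e.1 e.2)
    (hrow : ∀ a, (F.filter fun e => e.1 = a).card = k)
    (hcol : ∀ b, (F.filter fun e => e.2 = b).card = k) :
    IsSubgraphOfRegularBipartite G A d := by
  -- The complete bipartite graph on `A`, `Aᶜ` with `F` removed.
  let H : SimpleGraph V :=
    { Adj := fun u v => (∃ (hu : u ∈ A) (hv : v ∈ Aᶜ), (⟨u, hu⟩, ⟨v, hv⟩) ∉ F) ∨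
        ∃ (hv : v ∈ A) (hu : u ∈ Aᶜ), (⟨v, hv⟩, ⟨u, hu⟩) ∉ F
      symm := ⟨fun u v h => h.symm⟩
      loopless := ⟨fun u h => by
        rcases h with ⟨h, h', -⟩ | ⟨h, h', -⟩ <;> exact h' h⟩ }
  refine ⟨H, fun v => Fintype.ofFinite _, ?_, ⟨disjoint_compl_right, ?_⟩, ?_⟩
  · intro u v huv
    obtain ⟨a, ha, b, hb, hab⟩ := hG u v huv
    rcases Sym2.eq_iff.1 hab with ⟨rfl, rfl⟩ | ⟨rfl, rfl⟩
    · exact .inl ⟨ha, hb, fun h => hF _ h huv⟩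
    · exact .inr ⟨ha, hb, fun h => hF _ h huv.symm⟩
  · rintro u v (⟨hu, hv, -⟩ | ⟨hv, hu, -⟩)
    · exact .inl ⟨hu, hv⟩
    · exact .inr ⟨hu, hv⟩
  · intro v
    rw [← SimpleGraph.card_neighborFinset_eq_degree]
    by_cases hv : v ∈ A
    · have h1 : H.neighborFinset v = (Finset.univ.filter
          fun b : (Aᶜ : Set V) => ((⟨v, hv⟩ : A), b) ∉ F).map (.subtype _) := by
        ext u
        simp only [SimpleGraph.mem_neighborFinset, Finset.mem_map, Finset.mem_filter,
          Finset.mem_univ, true_and, Function.Embedding.subtype_apply]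
        constructor
        · rintro (⟨_, hu, h⟩ | ⟨_, hu, _⟩)
          · exact ⟨⟨u, hu⟩, h, rfl⟩
          · exact absurd hv hu
        · rintro ⟨b, hb, rfl⟩
          exact .inl ⟨hv, b.2, hb⟩
      have h2 : (Finset.univ.filter fun b : (Aᶜ : Set V) => ((⟨v, hv⟩ : A), b) ∈ F).card = k := by
        rw [← hrow ⟨v, hv⟩]
        refine Finset.card_bij' (fun b _ => (⟨v, hv⟩, b)) (fun e _ => e.2) ?_ ?_ ?_ ?_
        · simp
        · rintro ⟨a, b⟩ he
          obtain ⟨he, rfl⟩ := Finset.mem_filter.1 he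
          simpa using he
        · simp
        · rintro ⟨a, b⟩ he
          obtain ⟨he, rfl⟩ := Finset.mem_filter.1 he
          rfl
      have h3 := Finset.card_filter_add_card_filter_not (s := Finset.univ)
        (fun b : (Aᶜ : Set V) => ((⟨v, hv⟩ : A), b) ∈ F)
      rw [Finset.card_univ, hAc] at h3
      have h4 : (H.neighborFinset v).card = d := by
        rw [h1, Finset.card_map]
        omega
      convert h4
    · have h1 : H.neighborFinset v = (Finset.univ.filter
          fun a : A => (a, (⟨v, hv⟩ : (Aᶜ : Set V))) ∉ F).map (.subtype _) := by
        ext u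
        simp only [SimpleGraph.mem_neighborFinset, Finset.mem_map, Finset.mem_filter,
          Finset.mem_univ, true_and, Function.Embedding.subtype_apply]
        constructor
        · rintro (⟨hv', _, _⟩ | ⟨hu, _, h⟩)
          · exact absurd hv' hv
          · exact ⟨⟨u, hu⟩, h, rfl⟩
        · rintro ⟨a, ha, rfl⟩
          exact .inr ⟨a.2, hv, ha⟩
      have h2 : (Finset.univ.filter
          fun a : A => (a, (⟨v, hv⟩ : (Aᶜ : Set V))) ∈ F).card = k := by
        rw [← hcol ⟨v, hv⟩]
        refine Finset.card_bij' (fun a _ => (a, ⟨v, hv⟩)) (fun e _ => e.1) ?_ ?_ ?_ ?_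
        · simp
        · rintro ⟨a, b⟩ he
          obtain ⟨he, rfl⟩ := Finset.mem_filter.1 he
          simpa using he
        · simp
        · rintro ⟨a, b⟩ he
          obtain ⟨he, rfl⟩ := Finset.mem_filter.1 he
          rfl
      have h3 := Finset.card_filter_add_card_filter_not (s := Finset.univ)
        (fun a : A => (a, (⟨v, hv⟩ : (Aᶜ : Set V))) ∈ F)
      rw [Finset.card_univ, hA] at h3
      have h4 : (H.neighborFinset v).card = d := by
        rw [h1, Finset.card_map]
        omega
      convert h4

/-! ### The planted graph for a fixed bisection -/

/-- The crossing pair with the given endpoints in `A` and `Aᶜ`. -/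
def crossPair {V : Type*} (A : Set V) : A × (Aᶜ : Set V) ↪ Sym2 V where
  toFun e := s(e.1, e.2)
  inj' := by
    rintro ⟨⟨a, ha⟩, ⟨b, hb⟩⟩ ⟨⟨a', ha'⟩, ⟨b', hb'⟩⟩ h
    rcases Sym2.eq_iff.1 h with ⟨h1, h2⟩ | ⟨h1, h2⟩
    · simp only at h1 h2
      subst h1 h2
      rfl
    · simp only at h1 h2
      subst h1
      exact absurd ha hb'

theorem crosses_crossPair {V : Type*} (A : Set V) (e : A × (Aᶜ : Set V)) :
    Crosses A (crossPair A e) :=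
  ⟨e.1, e.1.2, e.2, e.2.2, rfl⟩

/-- Inside the parts of a bisection no pair is chosen when `p = 0`. -/
theorem ae_crosses {V : Type*} [Fintype V] (A : Set V) (q : unitInterval) :
    ∀ᵐ ω ∂(Measure.pi fun e : Sym2 V => bernoulliMeasure True False (edgeProb A 0 q e)),
      ∀ e, ω e → Crosses A e := by
  classical
  rw [ae_all_iff]
  intro e
  by_cases he : Crosses A e
  · simp [he]
  · have h1 : ∀ᵐ x ∂(bernoulliMeasure True False (edgeProb A 0 q e)), ¬ x := by
      simp [edgeProb, he, ae_dirac_eq]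
    have h2 := (Measure.quasiMeasurePreserving_eval
      (fun e : Sym2 V => bernoulliMeasure True False (edgeProb A 0 q e)) e).ae h1
    filter_upwards [h2] with ω hω h
    exact absurd h hω

open Classical in
/-- Union bound for the deviations of the numbers of non-edges in a finite family of sets of
crossing pairs. -/
theorem measureReal_exists_card_nonedges_lt {V κ : Type*} [Fintype V] [Fintype κ] (A : Set V)
    (q : unitInterval) (D : κ → Finset (A × (Aᶜ : Set V))) {M : ℝ}
    (hM : ∀ i, ((D i).card : ℝ) ≤ M) {l : ℝ} (hl : 0 < l) :
    (Measure.pi fun e : Sym2 V => bernoulliMeasure True False (edgeProb A 0 q e)).real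
      {ω | ∃ i, (((D i).filter fun e => ¬ ω (crossPair A e)).card : ℝ) <
        (1 - q) * (D i).card - l} ≤
      Fintype.card κ * Real.exp (-2 * l ^ 2 / M) := by
  have := measureReal_exists_card_filter_not_le (edgeProb A 0 q) q
    (fun i => (D i).map (crossPair A)) (by
      intro i e he
      obtain ⟨x, -, rfl⟩ := Finset.mem_map.1 he
      exact if_pos (crosses_crossPair A x)) (M := M) (by simpa using hM) hl
  simpa only [Finset.filter_map, Finset.card_map, Function.comp_def] using this

open Classical in
/-- Outside an event of small probability, the planted graph is contained in `d`-regular bipartite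
graphs for all integers `d` next to `q m + 2 w`. -/
theorem one_sub_le_plantedGraph {n m : ℕ} (hn : n = 2 * m) (A : Set (Fin n))
    (hA : A ∈ bisections n) (q : unitInterval) (hq : q < 1) {w : ℝ} (hw : 1 ≤ w)
    (hwm : 6 * w ≤ (1 - (q : ℝ)) ^ 2 * m) :
    1 - ENNReal.ofReal (2 * m * Real.exp (-2 * w ^ 2 / m) +
        4 ^ m * Real.exp (-2 * ((1 - (q : ℝ)) / 4 * w * m) ^ 2 / m ^ 2)) ≤
      plantedGraph n 0 q A {G | ∀ d : ℕ, |(d : ℝ) - (q * m + 2 * w)| < 1 →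
        IsSubgraphOfRegularBipartite G A d} := by
  have hp : 0 < 1 - (q : ℝ) := sub_pos.2 hq
  have hp1 : 1 - (q : ℝ) ≤ 1 := by linarith [q.2.1]
  set p : ℝ := 1 - (q : ℝ) with hpq
  have hcA : Fintype.card A = m := by
    have h : 2 * A.ncard = n := hA
    rw [← Nat.card_eq_fintype_card, Nat.card_coe_set_eq]
    omega
  have hcAc : Fintype.card (Aᶜ : Set (Fin n)) = m := by
    rw [Fintype.card_compl_set, hcA, Fintype.card_fin]
    omega
  have hm : (0 : ℝ) < m := by
    by_contra! h
    nlinarith [sq_nonneg p]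
  set μ := Measure.pi fun e : Sym2 (Fin n) => bernoulliMeasure True False (edgeProb A 0 q e)
    with hμ
  -- Stars `D₁` control degrees and rectangles `D₂` control edge counts. They need separate union
  -- bounds, with deviations `w` and `p / 4 * w * m`.
  let D₁ : A ⊕ (Aᶜ : Set (Fin n)) → Finset (A × (Aᶜ : Set (Fin n))) :=
    Sum.elim (fun a => Finset.univ.filter fun e => e.1 = a)
      (fun b => Finset.univ.filter fun e => e.2 = b)
  let D₂ : Finset A × Finset (Aᶜ : Set (Fin n)) → Finset (A × (Aᶜ : Set (Fin n))) :=
    fun x => x.1 ×ˢ x.2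
  have hD₁ : ∀ i, (D₁ i).card = m := by
    rintro (a | b)
    · have : D₁ (.inl a) = {a} ×ˢ Finset.univ := by
        ext e
        simp only [D₁, Sum.elim_inl, Finset.mem_filter, Finset.mem_product,
          Finset.mem_singleton, Finset.mem_univ, true_and, and_true]
      rw [this]
      simp only [Finset.card_product, Finset.card_singleton, one_mul, Finset.card_univ, hcAc]
    · have : D₁ (.inr b) = Finset.univ ×ˢ {b} := by
        ext e
        simp only [D₁, Sum.elim_inr, Finset.mem_filter, Finset.mem_product,
          Finset.mem_singleton, Finset.mem_univ, true_and]
      rw [this]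
      simp only [Finset.card_product, Finset.card_singleton, mul_one, Finset.card_univ, hcA]
  have hD₂ : ∀ i, ((D₂ i).card : ℝ) ≤ (m : ℝ) ^ 2 := by
    intro i
    have : (D₂ i).card ≤ m * m := by
      rw [Finset.card_product]
      exact Nat.mul_le_mul (hcA ▸ Finset.card_le_univ _) (hcAc ▸ Finset.card_le_univ _)
    rw [sq]
    exact_mod_cast this
  have hb₁ := measureReal_exists_card_nonedges_lt A q D₁ (M := m)
    (fun i => by rw [hD₁]) (l := w) (by linarith)
  have hb₂ := measureReal_exists_card_nonedges_lt A q D₂ (M := (m : ℝ) ^ 2)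
    hD₂ (l := p / 4 * w * m) (by positivity)
  rw [← hμ, ← hpq] at hb₁ hb₂
  set b₁ := {ω : Sym2 (Fin n) → Prop | ∃ i, (((D₁ i).filter fun e => ¬ ω (crossPair A e)).card : ℝ) <
        p * (D₁ i).card - w} with hb₁'
  set b₂ := {ω : Sym2 (Fin n) → Prop | ∃ i, (((D₂ i).filter fun e => ¬ ω (crossPair A e)).card : ℝ) <
        p * (D₂ i).card - p / 4 * w * m} with hb₂'
  set good := {G : SimpleGraph (Fin n) | ∀ d : ℕ, |(d : ℝ) - (q * m + 2 * w)| < 1 →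
        IsSubgraphOfRegularBipartite G A d} with hgood
  have hmain : ∀ᵐ ω ∂μ, ω ∈ ((fun ω : Sym2 (Fin n) → Prop =>
      SimpleGraph.fromEdgeSet {e | ω e}) ⁻¹' good)ᶜ → ω ∈ b₁ ∪ b₂ := by
    filter_upwards [ae_crosses A q] with ω hω hbad
    by_contra hb
    refine hbad fun d hd => ?_
    simp only [hb₁', hb₂', Set.mem_union, Set.mem_ofPred_eq, not_or, not_exists, not_lt] at hb
    obtain ⟨h1, h2⟩ := hb
    rw [abs_lt] at hd
    have hpm : p ^ 2 * m ≤ p * m := by nlinarith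
    have hdm : d ≤ m := by
      have : (d : ℝ) ≤ m := by
        have : (q : ℝ) = 1 - p := by rw [hpq]; ring
        rw [this] at hd
        nlinarith
      exact_mod_cast this
    have hkc : ((m - d : ℕ) : ℝ) = m - d := Nat.cast_sub hdm
    have hq' : (q : ℝ) = 1 - p := by rw [hpq]; ring
    rw [hq'] at hd
    -- Rounding costs less than 1 ≤ w, so k = m - d lies between pm - 3w and pm - w; the factor 6 in
    -- `hwm` makes the lower end at least pm/2.
    obtain ⟨F, hFB, hFr, hFc⟩ := exists_factor_of_pseudorandom
      (Finset.univ.filter fun e : A × (Aᶜ : Set (Fin n)) => ¬ ω (crossPair A e)) (m - d) m p w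
      hcA hcAc hp (by linarith) (by linarith) (by rw [hkc]; linarith) (by rw [hkc]; linarith)
      (fun a => by
        have := h1 (.inl a)
        rw [hD₁] at this
        simpa only [D₁, Sum.elim_inl, Finset.filter_filter, and_comm] using this)
      (fun b => by
        have := h1 (.inr b)
        rw [hD₁] at this
        simpa only [D₁, Sum.elim_inr, Finset.filter_filter, and_comm] using this)
      (fun S T => by
        have := h2 (S, T)
        have hset : (D₂ (S, T)).filter (fun e => ¬ ω (crossPair A e)) =
            (Finset.univ.filter fun e : A × (Aᶜ : Set (Fin n)) => ¬ ω (crossPair A e)).filter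
              fun e => e.1 ∈ S ∧ e.2 ∈ T := by
          ext e
          simp only [D₂, Finset.mem_filter, Finset.mem_product, Finset.mem_univ, true_and]
          exact and_comm
        rw [hset, Finset.card_product, Nat.cast_mul, ← mul_assoc] at this
        exact this)
    refine isSubgraphOfRegularBipartite_of_factor _ A (fun u v huv => ?_) d (m - d)
      (by omega) (by omega) F (fun e he hadj => ?_)
      (fun a => by convert hFr a) (fun b => by convert hFc b)
    · exact hω _ ((SimpleGraph.fromEdgeSet_adj _).1 huv).1
    · exact (Finset.mem_filter.1 (hFB he)).2 ((SimpleGraph.fromEdgeSet_adj _).1 hadj).1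
  have hbound : μ ((fun ω : Sym2 (Fin n) → Prop =>
      SimpleGraph.fromEdgeSet {e | ω e}) ⁻¹' good)ᶜ ≤
      ENNReal.ofReal (2 * m * Real.exp (-2 * w ^ 2 / m) +
        4 ^ m * Real.exp (-2 * (p / 4 * w * m) ^ 2 / m ^ 2)) := by
    refine (measure_mono_ae hmain).trans ((measure_union_le _ _).trans ?_)
    rw [ENNReal.ofReal_add (by positivity) (by positivity)]
    refine add_le_add ?_ ?_
    · rw [← ofReal_measureReal]
      refine ENNReal.ofReal_le_ofReal (hb₁.trans_eq ?_)
      rw [Fintype.card_sum, hcA, hcAc]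
      push_cast
      ring
    · rw [← ofReal_measureReal]
      refine ENNReal.ofReal_le_ofReal (hb₂.trans_eq ?_)
      rw [Fintype.card_prod, Fintype.card_finset, Fintype.card_finset, hcA, hcAc, ← mul_pow]
      norm_num
  have hmap : Measurable fun ω : Sym2 (Fin n) → Prop => SimpleGraph.fromEdgeSet {e | ω e} :=
    SimpleGraph.measurable_fromEdgeSet.comp (measurable_set_iff.2 fun e => measurable_pi_apply e)
  -- Only this inequality is needed, so measurability of `good` plays no role.
  refine le_trans ?_ (Measure.le_map_apply hmap.aemeasurable _)
  rw [← hμ, tsub_le_iff_right]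
  refine le_trans ?_ (add_le_add le_rfl hbound)
  rw [← measure_univ (μ := μ)]
  exact measure_univ_le_add_compl _

/-! ### Averaging over the bisection -/

/-- A lower bound for the measure of the fibres of a set is a lower bound for its measure under
the composition-product. -/
theorem le_compProd_of_ae_le {α β : Type*} [MeasurableSpace α] [MeasurableSpace β]
    (μ : Measure α) [IsProbabilityMeasure μ] (κ : Kernel α β) [IsSFiniteKernel κ]
    (s : Set (α × β)) (c : ENNReal) (h : ∀ᵐ a ∂μ, c ≤ κ a (Prod.mk a ⁻¹' s)) :
    c ≤ (μ ⊗ₘ κ) s := by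
  -- Passing to a measurable hull keeps the measure of `s` and only enlarges its fibres.
  rw [← measure_toMeasurable s, Measure.compProd_apply (measurableSet_toMeasurable _ _)]
  calc c = ∫⁻ _, c ∂μ := by simp
    _ ≤ _ := lintegral_mono_ae (h.mono fun a ha => ha.trans
      (measure_mono (Set.preimage_mono (subset_toMeasurable _ _))))

theorem bisections_nonempty {n : ℕ} (hn : Even n) : (bisections n).Nonempty := by
  obtain ⟨m, rfl⟩ := hn
  obtain ⟨t, -, ht⟩ := Finset.exists_subset_card_eq
    (s := (Finset.univ : Finset (Fin (m + m)))) (n := m) (by simp)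
  refine ⟨↑t, ?_⟩
  show 2 * (t : Set (Fin (m + m))).ncard = m + m
  rw [Set.ncard_coe_finset, ht, two_mul]

/-- Outside an event of small probability, a graph from the stochastic block model without edges
inside the parts is contained in `d`-regular bipartite graphs for all integers `d` next to
`dReg 2 q n`. -/
theorem one_sub_le_sbm (m : ℕ) (q : unitInterval) (hq : q < 1)
    (hw : 1 ≤ Real.sqrt (m * Real.log m))
    (hwm : 6 * Real.sqrt (m * Real.log m) ≤ (1 - (q : ℝ)) ^ 2 * m) :
    1 - ENNReal.ofReal (2 * m * Real.exp (-2 * Real.sqrt (m * Real.log m) ^ 2 / m) +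
        4 ^ m * Real.exp
          (-2 * ((1 - (q : ℝ)) / 4 * Real.sqrt (m * Real.log m) * m) ^ 2 / m ^ 2)) ≤
      sbm (2 * m) 0 q {x | ∀ d : ℕ, |(d : ℝ) - dReg 2 q (2 * m)| < 1 →
        IsSubgraphOfRegularBipartite x.2 x.1 d} := by
  have hfin : (bisections (2 * m)).Finite := Set.toFinite _
  have hne := bisections_nonempty (even_two_mul m)
  have := isProbabilityMeasure_uniformOn hfin hne
  refine le_compProd_of_ae_le _ _ _ _ ?_
  have hae : ∀ᵐ A ∂(uniformOn (bisections (2 * m))), A ∈ bisections (2 * m) :=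
    (prob_compl_eq_zero_iff hfin.measurableSet).2 (uniformOn_self hfin hne)
  filter_upwards [hae] with A hA
  have h := one_sub_le_plantedGraph rfl A hA q hq hw hwm
  have hd : dReg 2 q (2 * m) = q * m + 2 * Real.sqrt (m * Real.log m) := by
    have : ((2 * m : ℕ) : ℝ) / 2 = m := by push_cast; ring
    rw [dReg, this, mul_div_assoc, this]
  simp only [hd]
  exact h

/-! ### Asymptotics -/

/-- The first term equals 2/m. The second is exp(m log 4 - c² m log m / 8), at most exp(-m) once c²
log m ≥ 8(log 4 + 1): the logarithm in w beats the 4^m pairs of sets. -/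
theorem tendsto_failure_bound {c : ℝ} (hc : 0 < c) :
    Tendsto (fun m : ℕ => 2 * m * Real.exp (-2 * Real.sqrt (m * Real.log m) ^ 2 / m) +
      4 ^ m * Real.exp (-2 * (c / 4 * Real.sqrt (m * Real.log m) * m) ^ 2 / m ^ 2))
      atTop (𝓝 0) := by
  have hlog : Tendsto (fun m : ℕ => Real.log m) atTop atTop :=
    Real.tendsto_log_atTop.comp tendsto_natCast_atTop_atTop
  rw [← add_zero (0 : ℝ)]
  refine Tendsto.add ?_ ?_
  · have h : Tendsto (fun m : ℕ => (2 : ℝ) / m) atTop (𝓝 0) :=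
      tendsto_const_div_atTop_nhds_zero_nat 2
    refine h.congr' ?_
    filter_upwards [eventually_ge_atTop 1] with m hm
    have hm' : (1 : ℝ) ≤ m := by exact_mod_cast hm
    have hm0 : (0 : ℝ) < m := by linarith
    rw [Real.sq_sqrt (mul_nonneg hm0.le (Real.log_nonneg hm'))]
    have : -2 * (m * Real.log m) / m = -Real.log m + -Real.log m := by field_simp; ring
    rw [this, Real.exp_add, Real.exp_neg, Real.exp_log hm0]
    field_simp
  · have h : Tendsto (fun m : ℕ => Real.exp (-(m : ℝ))) atTop (𝓝 0) :=
      Real.tendsto_exp_neg_atTop_nhds_zero.comp tendsto_natCast_atTop_atTop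
    refine squeeze_zero' (.of_forall fun m => by positivity) ?_ h
    filter_upwards [eventually_ge_atTop 1,
      hlog.eventually_ge_atTop (8 * (Real.log 4 + 1) / c ^ 2)] with m hm hl
    have hm' : (1 : ℝ) ≤ m := by exact_mod_cast hm
    have hm0 : (0 : ℝ) < m := by linarith
    have h4 : (4 : ℝ) ^ m = Real.exp (m * Real.log 4) := by
      rw [Real.exp_nat_mul, Real.exp_log (by norm_num)]
    rw [h4, ← Real.exp_add, mul_pow, mul_pow,
      Real.sq_sqrt (mul_nonneg hm0.le (Real.log_nonneg hm'))]
    refine Real.exp_le_exp.2 ?_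
    have : -2 * ((c / 4) ^ 2 * (m * Real.log m) * m ^ 2) / m ^ 2 =
        -(m * (c ^ 2 * Real.log m / 8)) := by field_simp; ring
    rw [this]
    rw [div_le_iff₀ (by positivity)] at hl
    nlinarith

theorem eventually_six_mul_sqrt_le {c : ℝ} (hc : 0 < c) :
    ∀ᶠ m : ℕ in atTop, 6 * Real.sqrt (m * Real.log m) ≤ c * m := by
  have h := (Real.isLittleO_log_id_atTop.comp_tendsto tendsto_natCast_atTop_atTop).def
    (c := c ^ 2 / 36) (by positivity)
  filter_upwards [h, eventually_ge_atTop 1] with m hm h1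
  have hm' : (1 : ℝ) ≤ m := by exact_mod_cast h1
  simp only [Function.comp_apply, id, Real.norm_eq_abs, abs_of_nonneg (Real.log_nonneg hm'),
    Nat.abs_cast] at hm
  have : Real.sqrt (m * Real.log m) ≤ c * m / 6 := by
    refine Real.sqrt_le_iff.2 ⟨by positivity, ?_⟩
    nlinarith
  linarith

theorem eventually_one_le_sqrt :
    ∀ᶠ m : ℕ in atTop, 1 ≤ Real.sqrt (m * Real.log m) := by
  have hlog : Tendsto (fun m : ℕ => Real.log m) atTop atTop :=
    Real.tendsto_log_atTop.comp tendsto_natCast_atTop_atTop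
  filter_upwards [eventually_ge_atTop 1, hlog.eventually_ge_atTop 1] with m h1 h2
  have hm' : (1 : ℝ) ≤ m := by exact_mod_cast h1
  exact Real.one_le_sqrt.2 (by nlinarith)

/-- Nonemptiness excludes odd `n`, which have no bisection. -/
instance (n : ℕ) (p q : unitInterval) [Nonempty (bisections n)] :
    IsProbabilityMeasure (sbm n p q) := by
  have := isProbabilityMeasure_uniformOn (Set.toFinite (bisections n))
    (Set.nonempty_coe_sort.1 inferInstance)
  unfold sbm
  infer_instance

end StochasticBlockModel

/-- The naturals at distance less than 1 from a nonnegative real are exactly its floor and ceiling.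
-/
theorem mainTheorem10 :
    ∃ C : ℝ, 0 < C ∧ ∀ q : unitInterval, 0 < q → q < 1 →
      Tendsto
        (fun n : ℕ => StochasticBlockModel.sbm n 0 q
          {x : Set (Fin n) × SimpleGraph (Fin n) |
            ∀ d : ℕ, |(d : ℝ) - StochasticBlockModel.dReg C q n| < 1 →
              StochasticBlockModel.IsSubgraphOfRegularBipartite x.2 x.1 d})
        (atTop ⊓ 𝓟 {n : ℕ | Even n}) (𝓝 1) := by
  -- One w absorbs the degree fluctuations, the other the rounding of d.
  refine ⟨2, two_pos, fun q _ hq => ?_⟩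
  have hp : 0 < 1 - (q : ℝ) := sub_pos.2 hq
  have hhalf : Tendsto (fun n : ℕ => n / 2) (atTop ⊓ 𝓟 {n : ℕ | Even n}) atTop :=
    (Nat.tendsto_div_const_atTop two_ne_zero).mono_left inf_le_left
  have heven : ∀ᶠ n : ℕ in atTop ⊓ 𝓟 {n : ℕ | Even n}, Even n :=
    mem_inf_of_right (mem_principal_self _)
  have hlim := ENNReal.Tendsto.sub (tendsto_const_nhds (x := (1 : ENNReal)))
    (ENNReal.tendsto_ofReal ((StochasticBlockModel.tendsto_failure_bound hp).comp hhalf))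
    (.inl ENNReal.one_ne_top)
  rw [ENNReal.ofReal_zero, tsub_zero] at hlim
  refine tendsto_of_tendsto_of_tendsto_of_le_of_le' hlim tendsto_const_nhds ?_ ?_
  · filter_upwards [heven, hhalf.eventually StochasticBlockModel.eventually_one_le_sqrt,
      hhalf.eventually (StochasticBlockModel.eventually_six_mul_sqrt_le (pow_pos hp 2))]
      with n hn h1 h2
    obtain ⟨m, rfl⟩ := even_iff_exists_two_mul.1 hn
    rw [Nat.mul_div_cancel_left m two_pos] at h1 h2
    simp only [Function.comp_apply, Nat.mul_div_cancel_left m two_pos]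
    exact StochasticBlockModel.one_sub_le_sbm m q hq h1 h2
  · filter_upwards [heven] with n hn
    have := (StochasticBlockModel.bisections_nonempty hn).to_subtype
    exact prob_le_one
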